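/- Let $(M,g)$ be a spacetime, that is, a connected smooth manifold (Hausdorff, second countable, of dimension $n+1$ with $n\ge 0$) with a smooth Lorentzian metric $g$ of signature $(-,+,\dots,+)$ and a time orientation given by a smooth timelike vector field $\vartheta$. A nonzero tangent vector $X$ is timelike if $g(X,X)<0$ and causal if $g(X,X)\le 0$; a causal vector $X$ is future-directed if $g(X,\vartheta)<0$ and past-directed if $g(X,\vartheta)>0$. Let $f\colon M\to\mathbb{R}$ be a smooth temporal function, that is, a smooth function whose gradient $\nabla f$ (defined by $g(\nabla f,X)=df(X)$ for all $X$) is everywhere past-directed timelike. Suppose there are $t\in\mathbb{R}$ and $C>0$ such that the level set $M_t=f^{-1}(t)$ is nonempty and $$g(\nabla f,\nabla f)=-C^2\quad\text{at every point of } M_t .$$ Then, for all $p,q\in M_t$, $$\hat d_f(p,q)\le C\,d_{h_t}(p,q).$$ Here $h_t$ is the Riemannian metric induced by $g$ on the spacelike hypersurface $M_t$, and $d_{h_t}(p,q)\in[0,\infty]$ is the infimum of the $h_t$-lengths of $C^1$ curves in $M_t$ from $p$ to $q$ ($\infty$ if there are none). The null distance $\hat d_f(p,q)$ is $0$ if $p=q$,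 and otherwise is the infimum of $$\hat L_f(\beta)=\sum_{i=0}^{N-1}\bigl|f(\beta(s_{i+1}))-f(\beta(s_i))\bigr|$$ over all piecewise causal curves $\beta$ from $p$ to $q$, that is, curves $\beta\colon[a,b]\to M$ with a partition $a=s_0<\dots<s_N=b$ such that each restriction $\beta|_{[s_i,s_{i+1}]}$ is smooth and has velocity everywhere future-directed causal or everywhere past-directed causal. -/

import Mathlib

open Set Filter Topology MeasureTheory Bundle
open scoped Manifold ContDiff ENNReal

noncomputable section

namespace Spacetime

/-- A Lorentzian metric on a smooth manifold `M` of dimension `n + 1`: a smooth symmetric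
`(0,2)`-tensor field, each value of which has one negative and `n` positive directions, that is,
each tangent space has a basis in which it is `diag(-1, 1, …, 1)`. -/
structure LorentzianMetric (n : ℕ) (M : Type*) [TopologicalSpace M]
    [ChartedSpace (EuclideanSpace ℝ (Fin (n + 1))) M] [IsManifold (𝓡 (n + 1)) ∞ M] where
  /-- The bilinear form `g_x` on `T_x M`. -/
  val (x : M) : TangentSpace (𝓡 (n + 1)) x →L[ℝ] TangentSpace (𝓡 (n + 1)) x →L[ℝ] ℝ
  symm (x : M) (v w : TangentSpace (𝓡 (n + 1)) x) : val x v w = val x w v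
  signature (x : M) : ∃ e : Module.Basis (Fin (n + 1)) ℝ (TangentSpace (𝓡 (n + 1)) x),
    ∀ i j, val x (e i) (e j) = if i = j then (if i = 0 then -1 else 1) else 0
  contMDiff : ContMDiff (𝓡 (n + 1))
    ((𝓡 (n + 1)).prod 𝓘(ℝ, EuclideanSpace ℝ (Fin (n + 1)) →L[ℝ]
      EuclideanSpace ℝ (Fin (n + 1)) →L[ℝ] ℝ)) ∞
    (fun x ↦ TotalSpace.mk' (EuclideanSpace ℝ (Fin (n + 1)) →L[ℝ]
      EuclideanSpace ℝ (Fin (n + 1)) →L[ℝ] ℝ) x (val x))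

variable {n : ℕ} {M : Type*} [TopologicalSpace M]
  [ChartedSpace (EuclideanSpace ℝ (Fin (n + 1))) M] [IsManifold (𝓡 (n + 1)) ∞ M]

/-- A time orientation: a smooth vector field that is timelike at every point. -/
structure TimeOrientation (g : LorentzianMetric n M) where
  /-- The vector field `ϑ`. -/
  field (x : M) : TangentSpace (𝓡 (n + 1)) x
  timelike (x : M) : g.val x (field x) (field x) < 0
  contMDiff : ContMDiff (𝓡 (n + 1)) (𝓡 (n + 1)).tangent ∞
    (fun x ↦ (⟨x, field x⟩ : TangentBundle (𝓡 (n + 1)) M))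

/-- A tangent vector is timelike if `g(v, v) < 0` (in particular it is nonzero). -/
def IsTimelike (g : LorentzianMetric n M) {x : M} (v : TangentSpace (𝓡 (n + 1)) x) : Prop :=
  g.val x v v < 0

/-- A tangent vector is causal if it is nonzero and timelike or null. -/
def IsCausal (g : LorentzianMetric n M) {x : M} (v : TangentSpace (𝓡 (n + 1)) x) : Prop :=
  v ≠ 0 ∧ g.val x v v ≤ 0

/-- The condition `g(v, ϑ) < 0` that makes a causal vector future-directed. -/
def FutureDirected {g : LorentzianMetric n M} (θ : TimeOrientation g) {x : M}
    (v : TangentSpace (𝓡 (n + 1)) x) : Prop :=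
  g.val x v (θ.field x) < 0

/-- The condition `g(v, ϑ) > 0` that makes a causal vector past-directed. -/
def PastDirected {g : LorentzianMetric n M} (θ : TimeOrientation g) {x : M}
    (v : TangentSpace (𝓡 (n + 1)) x) : Prop :=
  0 < g.val x v (θ.field x)

/-- Nondegeneracy of `g`, in the form that is needed to define gradients. -/
theorem existsUnique_gradient (g : LorentzianMetric n M) (f : M → ℝ) (x : M) :
    ∃! v : TangentSpace (𝓡 (n + 1)) x, ∀ w, g.val x v w = mvfderiv (𝓡 (n + 1)) f x w := by
  obtain ⟨e, he⟩ := g.signature x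
  have key : ∀ v j, g.val x v (e j) = (if j = 0 then -1 else 1) * e.repr v j := by
    intro v j
    conv_lhs => rw [← e.sum_repr v]
    rw [map_sum, sum_apply]
    simp only [map_smul, smul_apply, he, smul_eq_mul]
    simp [mul_comm]
  have hext : ∀ (v : TangentSpace (𝓡 (n + 1)) x),
      (∀ w, g.val x v w = mvfderiv (𝓡 (n + 1)) f x w) ↔
        ∀ j, g.val x v (e j) = mvfderiv (𝓡 (n + 1)) f x (e j) := by
    intro v
    refine ⟨fun h j ↦ h _, fun h w ↦ ?_⟩
    have := e.ext (f₁ := (g.val x v).toLinearMap) (f₂ := (mvfderiv (𝓡 (n + 1)) f x).toLinearMap)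
      (fun j ↦ h j)
    exact DFunLike.congr_fun this w
  refine ⟨∑ i, ((if i = 0 then -1 else 1) * mvfderiv (𝓡 (n + 1)) f x (e i)) • e i, ?_, ?_⟩
  · simp only [hext]
    intro j
    rw [key, e.repr_sum_self]
    split_ifs <;> simp
  · intro v hv
    simp only [hext] at hv
    rw [← e.sum_repr v]
    refine Finset.sum_congr rfl fun j _ ↦ ?_
    rw [← hv j, key]
    split_ifs <;> simp

/-- The gradient of `f` at `x`: the unique vector `v` with `g(v, w) = df_x(w)` for all `w`. -/
def gradient (g : LorentzianMetric n M) (f : M → ℝ) (x : M) : TangentSpace (𝓡 (n + 1)) x :=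
  (existsUnique_gradient g f x).choose

theorem gradient_spec (g : LorentzianMetric n M) (f : M → ℝ) (x : M)
    (w : TangentSpace (𝓡 (n + 1)) x) :
    g.val x (gradient g f x) w = mvfderiv (𝓡 (n + 1)) f x w :=
  (existsUnique_gradient g f x).choose_spec.1 w

/-- A temporal function: a differentiable function whose gradient is everywhere past-directed
timelike. -/
def IsTemporal {g : LorentzianMetric n M} (θ : TimeOrientation g) (f : M → ℝ) : Prop :=
  MDifferentiable (𝓡 (n + 1)) 𝓘(ℝ, ℝ) f ∧
    ∀ x, IsTimelike g (gradient g f x) ∧ PastDirected θ (gradient g f x)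

/-- The velocity at time `s` of a curve defined on `[a, b]` (one-sided at the end points). -/
def velocity (γ : ℝ → M) (a b s : ℝ) : TangentSpace (𝓡 (n + 1)) (γ s) :=
  mfderivWithin 𝓘(ℝ, ℝ) (𝓡 (n + 1)) γ (Icc a b) s (1 : ℝ)

/-- `γ` restricted to `[a, b]` is a smooth future-directed causal curve. -/
def IsFutureCausalCurve {g : LorentzianMetric n M} (θ : TimeOrientation g)
    (γ : ℝ → M) (a b : ℝ) : Prop :=
  ContMDiffOn 𝓘(ℝ, ℝ) (𝓡 (n + 1)) ∞ γ (Icc a b) ∧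
    ∀ s ∈ Icc a b, IsCausal g (velocity γ a b s) ∧ FutureDirected θ (velocity γ a b s)

/-- `γ` restricted to `[a, b]` is a smooth past-directed causal curve. -/
def IsPastCausalCurve {g : LorentzianMetric n M} (θ : TimeOrientation g)
    (γ : ℝ → M) (a b : ℝ) : Prop :=
  ContMDiffOn 𝓘(ℝ, ℝ) (𝓡 (n + 1)) ∞ γ (Icc a b) ∧
    ∀ s ∈ Icc a b, IsCausal g (velocity γ a b s) ∧ PastDirected θ (velocity γ a b s)

/-- A piecewise causal curve from `p` to `q`, together with its breakpoints `s_0 < ⋯ < s_N`,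
`N ≥ 1`. Only the values of `toFun` on `[s_0, s_N]` matter. -/
structure PiecewiseCausalCurve {g : LorentzianMetric n M} (θ : TimeOrientation g) (p q : M) where
  /-- The curve. -/
  toFun : ℝ → M
  /-- The number of pieces. -/
  N : ℕ
  N_pos : 0 < N
  /-- The breakpoints. -/
  s : Fin (N + 1) → ℝ
  strictMono_s : StrictMono s
  source : toFun (s 0) = p
  target : toFun (s (Fin.last N)) = q
  causal (i : Fin N) : IsFutureCausalCurve θ toFun (s i.castSucc) (s i.succ) ∨
    IsPastCausalCurve θ toFun (s i.castSucc) (s i.succ)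

/-- The null length of a piecewise causal curve with respect to `τ`. -/
def nullLength {g : LorentzianMetric n M} {θ : TimeOrientation g} (τ : M → ℝ) {p q : M}
    (β : PiecewiseCausalCurve θ p q) : ℝ :=
  ∑ i : Fin β.N, |τ (β.toFun (β.s i.succ)) - τ (β.toFun (β.s i.castSucc))|

open Classical in
/-- The null distance with respect to `τ`: the infimum of the null lengths of the piecewise causal
curves from `p` to `q`, and `0` if `p = q`. It takes values in `[0, ∞]`, so that the infimum over
no curves at all would be `∞`. -/
def nullDist {g : LorentzianMetric n M} (θ : TimeOrientation g) (τ : M → ℝ) (p q : M) : ℝ≥0∞ :=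
  if p = q then 0 else ⨅ β : PiecewiseCausalCurve θ p q, ENNReal.ofReal (nullLength τ β)

/-- A `C^1` curve on `[0, 1]` from `p` to `q` in the level set `f⁻¹(t)`. When `f` is a smooth
temporal function, `f⁻¹(t)` is an embedded hypersurface, and these are exactly the `C^1` curves
in that hypersurface. -/
structure LevelCurve (n : ℕ) {M : Type*} [TopologicalSpace M]
    [ChartedSpace (EuclideanSpace ℝ (Fin (n + 1))) M] (f : M → ℝ) (t : ℝ) (p q : M) where
  /-- The curve. -/
  toFun : ℝ → M
  contMDiffOn : ContMDiffOn 𝓘(ℝ, ℝ) (𝓡 (n + 1)) 1 toFun (Icc 0 1)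
  source : toFun 0 = p
  target : toFun 1 = q
  mem (s : ℝ) : s ∈ Icc (0 : ℝ) 1 → f (toFun s) = t

/-- The tangent space `T_x M_t = ker df_x` at `x` of the level set `M_t` of `f` through `x`. -/
def levelTangentSpace (n : ℕ) {M : Type*} [TopologicalSpace M]
    [ChartedSpace (EuclideanSpace ℝ (Fin (n + 1))) M] (f : M → ℝ) (x : M) :
    Submodule ℝ (TangentSpace (𝓡 (n + 1)) x) :=
  (mvfderiv (𝓡 (n + 1)) f x).toLinearMap.ker

/-- The induced metric `h_t` at `x`: the restriction of `g_x` to the tangent space of the level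
set of `f` through `x`. -/
def inducedMetric (g : LorentzianMetric n M) (f : M → ℝ) (x : M)
    (v w : levelTangentSpace n f x) : ℝ :=
  g.val x (v : TangentSpace (𝓡 (n + 1)) x) (w : TangentSpace (𝓡 (n + 1)) x)

/-- The level sets of a temporal function are spacelike: the induced metric is positive
definite. -/
theorem inducedMetric_pos {g : LorentzianMetric n M} {θ : TimeOrientation g} {f : M → ℝ}
    (hf : IsTemporal θ f) (x : M) (v : levelTangentSpace n f x) (hv : v ≠ 0) :
    0 < inducedMetric g f x v v := by
  obtain ⟨w, hw⟩ := v
  have hw0 : w ≠ 0 := fun h ↦ hv (Subtype.ext h)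
  have hu := (hf.2 x).1
  have huw : g.val x (gradient g f x) w = 0 := by
    rw [gradient_spec]
    exact hw
  change 0 < g.val x w w
  unfold IsTimelike at hu
  generalize gradient g f x = u at hu huw
  obtain ⟨e, he⟩ := g.signature x
  have key : ∀ a b, g.val x a b =
      -(e.repr a 0 * e.repr b 0) + ∑ i : Fin n, e.repr a i.succ * e.repr b i.succ := by
    intro a b
    conv_lhs => rw [← e.sum_repr a, ← e.sum_repr b]
    simp only [map_sum, map_smul, sum_apply, smul_apply, he, smul_eq_mul]
    simp [Fin.sum_univ_succ, mul_comm]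
  rw [key] at hu huw ⊢
  have hcs := Finset.sum_mul_sq_le_sq_mul_sq Finset.univ
    (fun i : Fin n ↦ e.repr u i.succ) (fun i : Fin n ↦ e.repr w i.succ)
  simp only [← pow_two] at hu ⊢
  set A := ∑ i : Fin n, e.repr u i.succ ^ 2
  set B := ∑ i : Fin n, e.repr w i.succ ^ 2 with hB
  have hA0 : 0 ≤ A := Finset.sum_nonneg fun i _ ↦ sq_nonneg _
  have hB0 : 0 ≤ B := Finset.sum_nonneg fun i _ ↦ sq_nonneg _
  rw [show ∑ i : Fin n, e.repr u i.succ * e.repr w i.succ = e.repr u 0 * e.repr w 0 by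
    linarith] at hcs
  have hu0 : 0 < e.repr u 0 ^ 2 := by linarith
  rcases hB0.eq_or_lt with h0 | h0
  · exfalso
    rw [← h0, mul_zero, mul_pow] at hcs
    have hw1 : e.repr w 0 = 0 := by
      by_contra h
      have : 0 < e.repr w 0 ^ 2 := by positivity
      nlinarith [mul_pos hu0 this]
    apply hw0
    apply e.ext_elem
    intro i
    rw [map_zero, Finsupp.zero_apply]
    refine Fin.cases hw1 (fun j ↦ ?_) i
    rw [hB, eq_comm, Finset.sum_eq_zero_iff_of_nonneg fun i _ ↦ sq_nonneg _] at h0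
    simpa using h0 j (Finset.mem_univ j)
  · rw [mul_pow] at hcs
    by_contra hcon
    have h1 : B ≤ e.repr w 0 ^ 2 := by linarith
    nlinarith [mul_le_mul_of_nonneg_left h1 hu0.le,
      mul_pos (show 0 < e.repr u 0 ^ 2 - A by linarith) h0]

/-- The velocity of a curve in a level set is tangent to the level set. -/
theorem LevelCurve.velocity_mem {n : ℕ} {M : Type*} [TopologicalSpace M]
    [ChartedSpace (EuclideanSpace ℝ (Fin (n + 1))) M] {f : M → ℝ}
    (hf : MDifferentiable (𝓡 (n + 1)) 𝓘(ℝ, ℝ) f)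
    {t : ℝ} {p q : M} (γ : LevelCurve n f t p q) {s : ℝ} (hs : s ∈ Icc (0 : ℝ) 1) :
    velocity γ.toFun 0 1 s ∈ levelTangentSpace n f (γ.toFun s) := by
  have hu : UniqueMDiffWithinAt 𝓘(ℝ, ℝ) (Icc (0 : ℝ) 1) s :=
    (uniqueDiffOn_Icc zero_lt_one s hs).uniqueMDiffWithinAt
  have h1 := mfderiv_comp_mfderivWithin s (hf (γ.toFun s))
    ((γ.contMDiffOn s hs).mdifferentiableWithinAt one_ne_zero) hu
  have h2 : mfderivWithin 𝓘(ℝ, ℝ) 𝓘(ℝ, ℝ) (f ∘ γ.toFun) (Icc 0 1) s =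
      mfderivWithin 𝓘(ℝ, ℝ) 𝓘(ℝ, ℝ) (fun _ ↦ t) (Icc 0 1) s :=
    mfderivWithin_congr (fun y hy ↦ γ.mem y hy) (γ.mem s hs)
  rw [mfderivWithin_const] at h2
  rw [h1] at h2
  exact DFunLike.congr_fun h2 (1 : ℝ)

/-- The length of a curve in a level set, measured with the induced metric. -/
def levelLength (g : LorentzianMetric n M) {f : M → ℝ}
    (hf : MDifferentiable (𝓡 (n + 1)) 𝓘(ℝ, ℝ) f) {t : ℝ} {p q : M}
    (γ : LevelCurve n f t p q) : ℝ≥0∞ :=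
  ∫⁻ s : Icc (0 : ℝ) 1, ENNReal.ofReal √(inducedMetric g f (γ.toFun s)
    ⟨velocity γ.toFun 0 1 s, γ.velocity_mem hf s.2⟩
    ⟨velocity γ.toFun 0 1 s, γ.velocity_mem hf s.2⟩)

/-- The Riemannian distance of the induced metric on the level set `f⁻¹(t)`, with values in
`[0, ∞]`: it is `∞` exactly between points that no curve in the level set joins. -/
def levelDist (g : LorentzianMetric n M) {f : M → ℝ}
    (hf : MDifferentiable (𝓡 (n + 1)) 𝓘(ℝ, ℝ) f) (t : ℝ) (p q : M) : ℝ≥0∞ :=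
  ⨅ γ : LevelCurve n f t p q, levelLength g hf γ

end Spacetime

end

namespace Spacetime

/-! ### Timelike vectors, the sign of `df`, and coordinate vectors -/

section Pointwise

variable {n : ℕ} {M : Type*} [TopologicalSpace M]
  [ChartedSpace (EuclideanSpace ℝ (Fin (n + 1))) M] [IsManifold (𝓡 (n + 1)) ∞ M]
  {g : LorentzianMetric n M} {θ : TimeOrientation g} {f : M → ℝ}

/-! A curve in the level set is shadowed by a fine zigzag of short timelike segments. Let `v` be
tangent to `M_t` at `x` and let `k > C |v|`. As the gradient is orthogonal to `v` and has square
`-C²`, the vectors `v/2 ∓ (k/(2C²)) ∇f` are timelike, sum to `v`, and have `df = ± k/2`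
(`exists_timelike_split`). Following `h` times the first and then `h` times the second leads to `x +
hv` in a chart, at null length about `kh`. Being timelike is an open condition, so the second leg
can be bent by a small multiple of `h` to end exactly on the given curve.

Hence, for every `κ > C |γ'(s₀)|`, passing between `γ s₀` and a nearby `γ s` changes the null
distance from any base point by at most `κ |s - s₀|` (`LevelCurve.exists_nullDist_step`). Continuity
of the speed and a supremum argument on `[0, 1]` turn this into an integral bound with integrand `C
|γ'| + ε`; then `ε → 0`, and the infimum is taken over `γ`.

The condition on the gradient is used only at points of the curve. The corners of the zigzag leave
`M_t`, but there only openness matters. -/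

theorem val_nonneg_of_mvfderiv_eq_zero (hf : IsTemporal θ f) {x : M}
    {w : TangentSpace (𝓡 (n + 1)) x} (hw : mvfderiv (𝓡 (n + 1)) f x w = 0) :
    0 ≤ g.val x w w := by
  by_cases h : w = 0
  · simp [h]
  · exact (inducedMetric_pos hf x ⟨w, hw⟩ fun h' ↦ h (congrArg Subtype.val h')).le

/-- A timelike vector along which a temporal function has nonzero derivative `α` satisfies
`α * g(a, ϑ) < 0`. -/
theorem mvfderiv_mul_val_field_neg (hf : IsTemporal θ f) {x : M}
    {a : TangentSpace (𝓡 (n + 1)) x} (ha : g.val x a a < 0)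
    (hα : mvfderiv (𝓡 (n + 1)) f x a ≠ 0) :
    mvfderiv (𝓡 (n + 1)) f x a * g.val x a (θ.field x) < 0 := by
  have hβ : 0 < mvfderiv (𝓡 (n + 1)) f x (θ.field x) := by
    rw [← gradient_spec g]; exact (hf.2 x).2
  set α := mvfderiv (𝓡 (n + 1)) f x a with hα'
  set β := mvfderiv (𝓡 (n + 1)) f x (θ.field x) with hβ'
  -- This combination lies in `ker df`, where `g` is nonnegative. In the expansion of its square
  -- both pure terms are negative, so the cross term `-2αβ g(a, ϑ)` must be positive, and `β > 0`.
  have hz : mvfderiv (𝓡 (n + 1)) f x (β • a - α • θ.field x) = 0 := by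
    rw [map_sub, map_smul, map_smul, ← hα', ← hβ', smul_eq_mul, smul_eq_mul, mul_comm, sub_self]
  have h := val_nonneg_of_mvfderiv_eq_zero hf hz
  simp only [map_sub, map_smul, sub_apply, smul_apply, smul_eq_mul] at h
  rw [g.symm x (θ.field x) a] at h
  have hθ := θ.timelike x
  have h1 : 0 < α ^ 2 := by positivity
  have h2 : 0 < β ^ 2 := by positivity
  by_contra hc
  push Not at hc
  nlinarith [mul_pos_of_neg_of_neg (neg_lt_zero.2 h1) hθ, mul_pos_of_neg_of_neg (neg_lt_zero.2 h2) ha,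
    mul_nonneg hβ.le hc]

theorem continuous_val_self (g : LorentzianMetric n M) :
    Continuous fun v : TangentBundle (𝓡 (n + 1)) M ↦ g.val v.1 v.2 v.2 := by
  have h : Continuous fun v : TangentBundle (𝓡 (n + 1)) M ↦
      TotalSpace.mk' ℝ (E := Bundle.Trivial M ℝ) v.1 (g.val v.1 v.2 v.2) := by
    apply Continuous.clm_bundle_apply₂ (F₁ := EuclideanSpace ℝ (Fin (n + 1)))
      (F₂ := EuclideanSpace ℝ (Fin (n + 1)))
    · exact g.contMDiff.continuous.comp (FiberBundle.continuous_proj _ _)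
    · exact continuous_id
    · exact continuous_id
  exact continuous_snd.comp ((Bundle.Trivial.homeomorphProd M ℝ).continuous.comp h)

theorem continuous_mvfderiv (hf : ContMDiff (𝓡 (n + 1)) 𝓘(ℝ, ℝ) ∞ f) :
    Continuous fun v : TangentBundle (𝓡 (n + 1)) M ↦ mvfderiv (𝓡 (n + 1)) f v.1 v.2 := by
  have h := hf.continuous_tangentMap (by simp)
  exact continuous_snd.comp ((tangentBundleModelSpaceHomeomorph 𝓘(ℝ, ℝ)).continuous.comp h)

/-- The coordinate vector `b` at the point with coordinates `z` in the chart at `x₀`. -/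
noncomputable def chartVector (n : ℕ) {M : Type*} [TopologicalSpace M]
    [ChartedSpace (EuclideanSpace ℝ (Fin (n + 1))) M] (x₀ : M)
    (z b : EuclideanSpace ℝ (Fin (n + 1))) : TangentBundle (𝓡 (n + 1)) M :=
  ⟨(extChartAt (𝓡 (n + 1)) x₀).symm z,
    mfderivWithin 𝓘(ℝ, EuclideanSpace ℝ (Fin (n + 1))) (𝓡 (n + 1))
      (extChartAt (𝓡 (n + 1)) x₀).symm (extChartAt (𝓡 (n + 1)) x₀).target z b⟩

/-- This is the tangent map of the inverse chart. Joint continuity in base point and vector is what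
makes timelikeness an open condition in coordinates. -/
theorem continuousAt_chartVector (x₀ : M) (a : EuclideanSpace ℝ (Fin (n + 1))) :
    ContinuousAt (fun w : EuclideanSpace ℝ (Fin (n + 1)) × EuclideanSpace ℝ (Fin (n + 1)) ↦
      chartVector n x₀ w.1 w.2) (extChartAt (𝓡 (n + 1)) x₀ x₀, a) := by
  have ho := isOpen_extChartAt_target (I := 𝓡 (n + 1)) x₀
  have h := (contMDiffOn_extChartAt_symm (I := 𝓡 (n + 1)) (n := ∞) x₀).continuousOn_tangentMapWithin
    (by simp) ho.uniqueMDiffOn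
  have h' := h.comp (g := _) (f := (tangentBundleModelSpaceHomeomorph
    𝓘(ℝ, EuclideanSpace ℝ (Fin (n + 1)))).symm) (s := Prod.fst ⁻¹' (extChartAt (𝓡 (n + 1)) x₀).target)
    (tangentBundleModelSpaceHomeomorph
      𝓘(ℝ, EuclideanSpace ℝ (Fin (n + 1)))).symm.continuous.continuousOn (fun w hw ↦ hw)
  exact h'.continuousAt ((ho.preimage continuous_fst).mem_nhds (mem_extChartAt_target x₀))

/-- The fibre at `x₀` is the model space, identified through the preferred chart at `x₀`, so the
derivative of the inverse of that chart at the base point is the identity. Vectors built invariantly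
at `x₀` thus serve directly as coordinate directions. -/
theorem chartVector_self (x₀ : M) (a : TangentSpace (𝓡 (n + 1)) x₀) :
    chartVector n x₀ (extChartAt (𝓡 (n + 1)) x₀ x₀) a =
      (⟨x₀, a⟩ : TangentBundle (𝓡 (n + 1)) M) := by
  have hb : x₀ ∈ (chartAt (EuclideanSpace ℝ (Fin (n + 1))) x₀).source := mem_chart_source _ x₀
  have h := TangentBundle.symmL_trivializationAt (I := 𝓡 (n + 1)) (x₀ := x₀) hb
  rw [TangentBundle.symmL_trivializationAt_eq_core hb, ModelWithCorners.range_eq_univ,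
    mfderivWithin_univ] at h
  have h1 : mfderiv 𝓘(ℝ, EuclideanSpace ℝ (Fin (n + 1))) (𝓡 (n + 1))
      (extChartAt (𝓡 (n + 1)) x₀).symm (extChartAt (𝓡 (n + 1)) x₀ x₀) a = a := by
    rw [← h]
    exact tangentCoordChange_self (I := 𝓡 (n + 1)) (mem_extChartAt_source x₀)
  have h2 := mfderivWithin_of_mem_nhds (I := 𝓘(ℝ, EuclideanSpace ℝ (Fin (n + 1))))
    (I' := 𝓡 (n + 1)) (f := (extChartAt (𝓡 (n + 1)) x₀).symm)
    ((isOpen_extChartAt_target (I := 𝓡 (n + 1)) x₀).mem_nhds (mem_extChartAt_target x₀))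
  have key : ∀ (x : M) (v : EuclideanSpace ℝ (Fin (n + 1))), x = x₀ → v = a →
      (⟨x, v⟩ : TangentBundle (𝓡 (n + 1)) M) = ⟨x₀, a⟩ := by
    rintro _ _ rfl rfl
    rfl
  exact key _ _ (extChartAt_to_inv x₀) ((congrArg (fun l ↦ l a) h2).trans h1)

/-- The value `g(v, v)` for the coordinate vector `v = b` at the point with coordinates `z`. -/
noncomputable def chartNormSq (g : LorentzianMetric n M) (x₀ : M)
    (z b : EuclideanSpace ℝ (Fin (n + 1))) : ℝ :=
  g.val _ (chartVector n x₀ z b).2 (chartVector n x₀ z b).2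

/-- The value `df(v)` for the coordinate vector `v = b` at the point with coordinates `z`. -/
noncomputable def chartDeriv (f : M → ℝ) (x₀ : M) (z b : EuclideanSpace ℝ (Fin (n + 1))) : ℝ :=
  mvfderiv (𝓡 (n + 1)) f _ (chartVector n x₀ z b).2

theorem chartNormSq_self (x₀ : M) (a : TangentSpace (𝓡 (n + 1)) x₀) :
    chartNormSq g x₀ (extChartAt (𝓡 (n + 1)) x₀ x₀) a = g.val x₀ a a :=
  congrArg (fun v : TangentBundle (𝓡 (n + 1)) M ↦ g.val v.1 v.2 v.2) (chartVector_self x₀ a)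

theorem chartDeriv_self (x₀ : M) (a : TangentSpace (𝓡 (n + 1)) x₀) :
    chartDeriv f x₀ (extChartAt (𝓡 (n + 1)) x₀ x₀) a = mvfderiv (𝓡 (n + 1)) f x₀ a :=
  congrArg (fun v : TangentBundle (𝓡 (n + 1)) M ↦ mvfderiv (𝓡 (n + 1)) f v.1 v.2)
    (chartVector_self x₀ a)

theorem chartNormSq_smul (x₀ : M) (z b : EuclideanSpace ℝ (Fin (n + 1))) (c : ℝ) :
    chartNormSq g x₀ z (c • b) = c ^ 2 * chartNormSq g x₀ z b := by
  have h := map_smul (mfderivWithin 𝓘(ℝ, EuclideanSpace ℝ (Fin (n + 1))) (𝓡 (n + 1))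
      (extChartAt (𝓡 (n + 1)) x₀).symm (extChartAt (𝓡 (n + 1)) x₀).target z) c b
  have h' := congrArg (fun v ↦ g.val _ v v) h
  refine h'.trans ?_
  simp only [map_smul, smul_apply, smul_eq_mul]
  rw [← mul_assoc, ← pow_two]
  rfl

omit [IsManifold (𝓡 (n + 1)) ∞ M] in
theorem chartDeriv_smul (x₀ : M) (z b : EuclideanSpace ℝ (Fin (n + 1))) (c : ℝ) :
    chartDeriv f x₀ z (c • b) = c * chartDeriv f x₀ z b := by
  have h := map_smul (mfderivWithin 𝓘(ℝ, EuclideanSpace ℝ (Fin (n + 1))) (𝓡 (n + 1))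
      (extChartAt (𝓡 (n + 1)) x₀).symm (extChartAt (𝓡 (n + 1)) x₀).target z) c b
  have h' := congrArg (fun v ↦ mvfderiv (𝓡 (n + 1)) f _ v) h
  exact h'.trans (map_smul _ _ _)

theorem continuousAt_chartNormSq (x₀ : M) (a : EuclideanSpace ℝ (Fin (n + 1))) :
    ContinuousAt (fun w : EuclideanSpace ℝ (Fin (n + 1)) × EuclideanSpace ℝ (Fin (n + 1)) ↦
      chartNormSq g x₀ w.1 w.2) (extChartAt (𝓡 (n + 1)) x₀ x₀, a) :=
  (continuous_val_self g).continuousAt.comp (continuousAt_chartVector x₀ a)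

theorem continuousAt_chartDeriv (hf : ContMDiff (𝓡 (n + 1)) 𝓘(ℝ, ℝ) ∞ f) (x₀ : M)
    (a : EuclideanSpace ℝ (Fin (n + 1))) :
    ContinuousAt (fun w : EuclideanSpace ℝ (Fin (n + 1)) × EuclideanSpace ℝ (Fin (n + 1)) ↦
      chartDeriv f x₀ w.1 w.2) (extChartAt (𝓡 (n + 1)) x₀ x₀, a) :=
  (continuous_mvfderiv hf).continuousAt.comp (continuousAt_chartVector x₀ a)

end Pointwise

/-! ### Causal segments in a chart -/

section Segments

variable {n : ℕ} {M : Type*} [TopologicalSpace M]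
  [ChartedSpace (EuclideanSpace ℝ (Fin (n + 1))) M] [IsManifold (𝓡 (n + 1)) ∞ M]
  {g : LorentzianMetric n M} {θ : TimeOrientation g} {f : M → ℝ}

/-- `q` can be reached from `p` by a smooth causal curve, future- or past-directed. -/
def CausallyJoined (θ : TimeOrientation g) (p q : M) : Prop :=
  ∃ σ : ℝ → M, σ 0 = p ∧ σ 1 = q ∧ (IsFutureCausalCurve θ σ 0 1 ∨ IsPastCausalCurve θ σ 0 1)

theorem contMDiffOn_chart_segment (x₀ : M) {y c : EuclideanSpace ℝ (Fin (n + 1))}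
    (hy : ∀ s ∈ Icc (0 : ℝ) 1, y + s • c ∈ (extChartAt (𝓡 (n + 1)) x₀).target) :
    ContMDiffOn 𝓘(ℝ, ℝ) (𝓡 (n + 1)) ∞
      (fun s : ℝ ↦ (extChartAt (𝓡 (n + 1)) x₀).symm (y + s • c)) (Icc 0 1) := by
  refine (contMDiffOn_extChartAt_symm (I := 𝓡 (n + 1)) x₀).comp (ContDiff.contMDiff ?_).contMDiffOn hy
  fun_prop

theorem velocity_chart_segment (x₀ : M) {y c : EuclideanSpace ℝ (Fin (n + 1))}
    (hy : ∀ s ∈ Icc (0 : ℝ) 1, y + s • c ∈ (extChartAt (𝓡 (n + 1)) x₀).target)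
    {s : ℝ} (hs : s ∈ Icc (0 : ℝ) 1) :
    velocity (n := n) (fun s : ℝ ↦ (extChartAt (𝓡 (n + 1)) x₀).symm (y + s • c)) 0 1 s =
      (chartVector n x₀ (y + s • c) c).2 := by
  have h1 : HasMFDerivWithinAt 𝓘(ℝ, EuclideanSpace ℝ (Fin (n + 1))) (𝓡 (n + 1))
      (extChartAt (𝓡 (n + 1)) x₀).symm (extChartAt (𝓡 (n + 1)) x₀).target (y + s • c)
      (mfderivWithin 𝓘(ℝ, EuclideanSpace ℝ (Fin (n + 1))) (𝓡 (n + 1))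
        (extChartAt (𝓡 (n + 1)) x₀).symm (extChartAt (𝓡 (n + 1)) x₀).target (y + s • c)) :=
    ((contMDiffOn_extChartAt_symm (I := 𝓡 (n + 1)) (n := ∞) x₀ _
      (hy s hs)).mdifferentiableWithinAt (by simp)).hasMFDerivWithinAt
  have h2 : HasDerivWithinAt (fun s : ℝ ↦ y + s • c) c (Icc 0 1) s := by
    simpa using (((hasDerivAt_id s).smul_const c).const_add y).hasDerivWithinAt
  have h3 := h1.comp s h2.hasFDerivWithinAt.hasMFDerivWithinAt hy
  have h4 := h3.mfderivWithin (uniqueDiffOn_Icc zero_lt_one s hs).uniqueMDiffWithinAt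
  have h5 := DFunLike.congr_fun h4 (1 : ℝ)
  refine h5.trans ?_
  exact congrArg (mfderivWithin 𝓘(ℝ, EuclideanSpace ℝ (Fin (n + 1))) (𝓡 (n + 1))
    (extChartAt (𝓡 (n + 1)) x₀).symm (extChartAt (𝓡 (n + 1)) x₀).target (y + s • c))
    (one_smul ℝ c)

/-- The time orientation of a timelike vector is read off from the sign of `df`. The constant `α`
fixes that sign along the whole segment, so the segment is future-directed throughout or
past-directed throughout. -/
theorem causallyJoined_chart_segment (hf : IsTemporal θ f) (x₀ : M)
    {y c : EuclideanSpace ℝ (Fin (n + 1))} {α : ℝ}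
    (hy : ∀ s ∈ Icc (0 : ℝ) 1, y + s • c ∈ (extChartAt (𝓡 (n + 1)) x₀).target)
    (hc : ∀ s ∈ Icc (0 : ℝ) 1, chartNormSq g x₀ (y + s • c) c < 0)
    (hα : ∀ s ∈ Icc (0 : ℝ) 1, 0 < α * chartDeriv f x₀ (y + s • c) c) :
    CausallyJoined θ ((extChartAt (𝓡 (n + 1)) x₀).symm y)
      ((extChartAt (𝓡 (n + 1)) x₀).symm (y + c)) := by
  refine ⟨fun s : ℝ ↦ (extChartAt (𝓡 (n + 1)) x₀).symm (y + s • c), by simp, by simp, ?_⟩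
  have key : ∀ s ∈ Icc (0 : ℝ) 1, ∀ v : TangentSpace (𝓡 (n + 1))
      ((extChartAt (𝓡 (n + 1)) x₀).symm (y + s • c)), v = (chartVector n x₀ (y + s • c) c).2 →
      IsCausal g v ∧ 0 < α * mvfderiv (𝓡 (n + 1)) f _ v ∧
        mvfderiv (𝓡 (n + 1)) f _ v * g.val _ v (θ.field _) < 0 := by
    rintro s hs v hv
    have h1 : g.val _ v v < 0 := by rw [hv]; exact hc s hs
    have h2 : 0 < α * mvfderiv (𝓡 (n + 1)) f _ v := by rw [hv]; exact hα s hs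
    have h3 : mvfderiv (𝓡 (n + 1)) f _ v ≠ 0 := right_ne_zero_of_mul h2.ne'
    exact ⟨⟨fun h ↦ h3 (by rw [h, map_zero]), h1.le⟩, h2, mvfderiv_mul_val_field_neg hf h1 h3⟩
  rcases lt_or_ge 0 α with h | h
  · refine Or.inl ⟨contMDiffOn_chart_segment x₀ hy, fun s hs ↦ ?_⟩
    obtain ⟨h1, h2, h3⟩ := key s hs _ (velocity_chart_segment x₀ hy hs)
    exact ⟨h1, neg_of_mul_neg_right h3 (pos_of_mul_pos_right h2 h.le).le⟩
  · refine Or.inr ⟨contMDiffOn_chart_segment x₀ hy, fun s hs ↦ ?_⟩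
    obtain ⟨h1, h2, h3⟩ := key s hs _ (velocity_chart_segment x₀ hy hs)
    exact ⟨h1, pos_of_mul_neg_right h3 (neg_of_mul_pos_right h2 h).le⟩

/-- Short chart segments in directions close to a timelike vector at `x₀` are causal. -/
theorem exists_causallyJoined_of_near (hf : IsTemporal θ f)
    (hfs : ContMDiff (𝓡 (n + 1)) 𝓘(ℝ, ℝ) ∞ f) (x₀ : M) {a : EuclideanSpace ℝ (Fin (n + 1))}
    (ha : chartNormSq g x₀ (extChartAt (𝓡 (n + 1)) x₀ x₀) a < 0)
    (hα : chartDeriv f x₀ (extChartAt (𝓡 (n + 1)) x₀ x₀) a ≠ 0) :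
    ∃ η > 0, ∀ y z : EuclideanSpace ℝ (Fin (n + 1)), ∀ h > 0,
      ‖y - extChartAt (𝓡 (n + 1)) x₀ x₀‖ < η → ‖z - extChartAt (𝓡 (n + 1)) x₀ x₀‖ < η →
      ‖z - y - h • a‖ < η * h →
      CausallyJoined θ ((extChartAt (𝓡 (n + 1)) x₀).symm y)
        ((extChartAt (𝓡 (n + 1)) x₀).symm z) := by
  set φ := extChartAt (𝓡 (n + 1)) x₀ with hφ
  set α := chartDeriv f x₀ (φ x₀) a with hα'
  have h1 := (continuousAt_chartNormSq (g := g) x₀ a).eventually_lt_const ha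
  have h2 := (continuousAt_const (y := α) |>.mul
    (continuousAt_chartDeriv hfs x₀ a)).eventually_const_lt (mul_self_pos.2 hα)
  have h3 : ∀ᶠ w : EuclideanSpace ℝ (Fin (n + 1)) × EuclideanSpace ℝ (Fin (n + 1)) in
      𝓝 (φ x₀, a), w.1 ∈ φ.target :=
    ((isOpen_extChartAt_target (I := 𝓡 (n + 1)) x₀).preimage continuous_fst).mem_nhds
      (mem_extChartAt_target x₀)
  obtain ⟨η, hη, hball⟩ := Metric.eventually_nhds_iff_ball.1 (h1.and (h2.and h3))
  refine ⟨η, hη, fun y z h hh hy hz hyz ↦ ?_⟩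
  -- Rescaling by `h⁻¹` makes the direction comparable with `a` at every scale. Positive rescaling
  -- preserves both sign conditions, so one `η` serves all `h`.
  have hmem : ∀ s ∈ Icc (0 : ℝ) 1, (y + s • (z - y), h⁻¹ • (z - y)) ∈
      Metric.ball (φ x₀, a) η := by
    intro s hs
    rw [← ball_prod_same]
    refine ⟨(convex_ball (φ x₀) η).add_smul_sub_mem (mem_ball_iff_norm.2 hy)
      (mem_ball_iff_norm.2 hz) hs, ?_⟩
    have : h⁻¹ • (z - y) - a = h⁻¹ • (z - y - h • a) := by
      rw [smul_sub _ (z - y), smul_smul, inv_mul_cancel₀ hh.ne', one_smul]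
    rw [mem_ball_iff_norm, this, norm_smul, norm_inv, Real.norm_of_nonneg hh.le,
      inv_mul_lt_iff₀ hh, mul_comm]
    exact hyz
  have key := causallyJoined_chart_segment (g := g) hf x₀ (y := y) (c := z - y) (α := α)
    (fun s hs ↦ (hball _ (hmem s hs)).2.2) (fun s hs ↦ ?_) (fun s hs ↦ ?_)
  · rwa [add_sub_cancel] at key
  · have h4 : chartNormSq g x₀ (y + s • (z - y)) (h⁻¹ • (z - y)) < 0 := (hball _ (hmem s hs)).1
    rw [chartNormSq_smul] at h4
    exact neg_of_mul_neg_right h4 (by positivity)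
  · have h4 : 0 < α * chartDeriv f x₀ (y + s • (z - y)) (h⁻¹ • (z - y)) :=
      (hball _ (hmem s hs)).2.1
    rw [chartDeriv_smul, mul_left_comm] at h4
    exact pos_of_mul_pos_right h4 (by positivity)

end Segments

/-! ### Concatenation of causal curves -/

section Concatenation

variable {n : ℕ} {M : Type*} [TopologicalSpace M]
  [ChartedSpace (EuclideanSpace ℝ (Fin (n + 1))) M] [IsManifold (𝓡 (n + 1)) ∞ M]
  {g : LorentzianMetric n M} {θ : TimeOrientation g} {f : M → ℝ}

omit [IsManifold (𝓡 (n + 1)) ∞ M] in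
theorem contMDiffOn_shift {γ : ℝ → M} (c : ℝ)
    (hγ : ContMDiffOn 𝓘(ℝ, ℝ) (𝓡 (n + 1)) ∞ γ (Icc 0 1)) :
    ContMDiffOn 𝓘(ℝ, ℝ) (𝓡 (n + 1)) ∞ (fun s ↦ γ (s - c)) (Icc c (c + 1)) := by
  refine hγ.comp (ContDiff.contMDiff (by fun_prop)).contMDiffOn fun s hs ↦ ?_
  rw [mem_Icc] at hs
  exact ⟨by linarith, by linarith⟩

omit [IsManifold (𝓡 (n + 1)) ∞ M] in
theorem velocity_shift {γ : ℝ → M} (c : ℝ)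
    (hγ : ContMDiffOn 𝓘(ℝ, ℝ) (𝓡 (n + 1)) ∞ γ (Icc 0 1)) {s : ℝ} (hs : s ∈ Icc c (c + 1)) :
    velocity (n := n) (fun s ↦ γ (s - c)) c (c + 1) s = velocity (n := n) γ 0 1 (s - c) := by
  have hmap : ∀ r ∈ Icc c (c + 1), r - c ∈ Icc (0 : ℝ) 1 := fun r hr ↦ by
    rw [mem_Icc] at hr
    exact ⟨by linarith, by linarith⟩
  have h1 : HasMFDerivWithinAt 𝓘(ℝ, ℝ) (𝓡 (n + 1)) γ (Icc 0 1) (s - c)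
      (mfderivWithin 𝓘(ℝ, ℝ) (𝓡 (n + 1)) γ (Icc 0 1) (s - c)) :=
    ((hγ _ (hmap s hs)).mdifferentiableWithinAt (by simp)).hasMFDerivWithinAt
  have h2 : HasDerivWithinAt (fun r : ℝ ↦ r - c) 1 (Icc c (c + 1)) s :=
    ((hasDerivAt_id s).sub_const c).hasDerivWithinAt
  have h3 := HasMFDerivWithinAt.comp (f := fun r : ℝ ↦ r - c) s h1
    h2.hasFDerivWithinAt.hasMFDerivWithinAt hmap
  have h4 := h3.mfderivWithin
    (uniqueDiffOn_Icc (lt_add_one c) s hs).uniqueMDiffWithinAt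
  refine (DFunLike.congr_fun h4 (1 : ℝ)).trans ?_
  exact congrArg (mfderivWithin 𝓘(ℝ, ℝ) (𝓡 (n + 1)) γ (Icc 0 1) (s - c)) (one_smul ℝ (1 : ℝ))

omit [IsManifold (𝓡 (n + 1)) ∞ M] in
-- The equality is in the tangent bundle because the two velocities lie in fibres over points that
-- are only propositionally equal.
theorem velocity_congr {γ γ' : ℝ → M} {a b : ℝ} (h : EqOn γ' γ (Icc a b)) {s : ℝ}
    (hs : s ∈ Icc a b) :
    (⟨γ' s, velocity (n := n) γ' a b s⟩ : TangentBundle (𝓡 (n + 1)) M) =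
      ⟨γ s, velocity (n := n) γ a b s⟩ := by
  have h1 : tangentMapWithin 𝓘(ℝ, ℝ) (𝓡 (n + 1)) γ' (Icc a b) ⟨s, (1 : ℝ)⟩ =
      tangentMapWithin 𝓘(ℝ, ℝ) (𝓡 (n + 1)) γ (Icc a b) ⟨s, (1 : ℝ)⟩ :=
    tangentMapWithin_congr h _ hs
  exact h1

theorem IsFutureCausalCurve.congr {γ γ' : ℝ → M} {a b : ℝ} (hγ : IsFutureCausalCurve θ γ a b)
    (h : EqOn γ' γ (Icc a b)) : IsFutureCausalCurve θ γ' a b := by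
  refine ⟨hγ.1.congr h, fun s hs ↦ ?_⟩
  have h1 := hγ.2 s hs
  have key : ∀ v w : TangentBundle (𝓡 (n + 1)) M, v = w →
      IsCausal g w.2 ∧ FutureDirected θ w.2 → IsCausal g v.2 ∧ FutureDirected θ v.2 := by
    rintro v _ rfl h
    exact h
  exact key _ _ (velocity_congr h hs) h1

theorem IsPastCausalCurve.congr {γ γ' : ℝ → M} {a b : ℝ} (hγ : IsPastCausalCurve θ γ a b)
    (h : EqOn γ' γ (Icc a b)) : IsPastCausalCurve θ γ' a b := by
  refine ⟨hγ.1.congr h, fun s hs ↦ ?_⟩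
  have h1 := hγ.2 s hs
  have key : ∀ v w : TangentBundle (𝓡 (n + 1)) M, v = w →
      IsCausal g w.2 ∧ PastDirected θ w.2 → IsCausal g v.2 ∧ PastDirected θ v.2 := by
    rintro v _ rfl h
    exact h
  exact key _ _ (velocity_congr h hs) h1

theorem IsFutureCausalCurve.shift {γ : ℝ → M} (hγ : IsFutureCausalCurve θ γ 0 1) (c : ℝ) :
    IsFutureCausalCurve θ (fun s ↦ γ (s - c)) c (c + 1) := by
  refine ⟨contMDiffOn_shift c hγ.1, fun s hs ↦ ?_⟩
  rw [velocity_shift c hγ.1 hs]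
  rw [mem_Icc] at hs
  exact hγ.2 (s - c) ⟨by linarith, by linarith⟩

theorem IsPastCausalCurve.shift {γ : ℝ → M} (hγ : IsPastCausalCurve θ γ 0 1) (c : ℝ) :
    IsPastCausalCurve θ (fun s ↦ γ (s - c)) c (c + 1) := by
  refine ⟨contMDiffOn_shift c hγ.1, fun s hs ↦ ?_⟩
  rw [velocity_shift c hγ.1 hs]
  rw [mem_Icc] at hs
  exact hγ.2 (s - c) ⟨by linarith, by linarith⟩

theorem CausallyJoined.exists_curve {p q : M} (h : CausallyJoined θ p q) (f : M → ℝ) :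
    ∃ β : PiecewiseCausalCurve θ p q, nullLength f β = |f q - f p| := by
  obtain ⟨σ, rfl, rfl, hσ⟩ := h
  refine ⟨⟨σ, 1, one_pos, fun i ↦ (i : ℕ), fun i j hij ↦ by simpa using hij, by simp, by simp,
    fun i ↦ ?_⟩, ?_⟩
  · obtain rfl := Subsingleton.elim i 0
    simpa using hσ
  · simp [nullLength]

theorem CausallyJoined.exists_append {p q r : M} (h : CausallyJoined θ q r) (f : M → ℝ)
    (β : PiecewiseCausalCurve θ p q) :
    ∃ β' : PiecewiseCausalCurve θ p r, nullLength f β' = nullLength f β + |f r - f q| := by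
  obtain ⟨σ, h0, h1, hσ⟩ := h
  set c := β.s (Fin.last β.N) with hc
  have hle : ∀ i, β.s i ≤ c := fun i ↦ β.strictMono_s.monotone (Fin.le_last i)
  set γ : ℝ → M := fun x ↦ if x ≤ c then β.toFun x else σ (x - c) with hγ
  have hγ1 : ∀ x ≤ c, γ x = β.toFun x := fun x hx ↦ if_pos hx
  -- The two formulas agree at `c`, which is needed because each piece lives on a closed interval.
  -- No smoothness across the corner is required.
  have hγ2 : ∀ x, c ≤ x → γ x = σ (x - c) := by
    intro x hx
    rcases hx.eq_or_lt with rfl | hx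
    · rw [hγ1 c le_rfl, hc, β.target, ← hc, sub_self, h0]
    · exact if_neg hx.not_ge
  set s' : Fin (β.N + 1 + 1) → ℝ := Fin.snoc (α := fun _ ↦ ℝ) β.s (c + 1) with hs'
  have hs1 : ∀ i : Fin (β.N + 1), s' i.castSucc = β.s i := fun i ↦ Fin.snoc_castSucc ..
  have hs2 : s' (Fin.last _) = c + 1 := Fin.snoc_last ..
  have hs3 : s' (Fin.last β.N).castSucc = c := hs1 _
  have hlast : γ (c + 1) = r := by rw [hγ2 _ (by linarith), add_sub_cancel_left, h1]
  refine ⟨⟨γ, β.N + 1, Nat.succ_pos _, s', ?_, ?_, ?_, ?_⟩, ?_⟩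
  · rw [Fin.strictMono_iff_lt_succ]
    intro i
    refine Fin.lastCases ?_ (fun j ↦ ?_) i
    · rw [hs3, Fin.succ_last, hs2]; linarith
    · rw [hs1, Fin.succ_castSucc, hs1]
      exact β.strictMono_s Fin.castSucc_lt_succ
  · rw [← Fin.castSucc_zero, hs1, hγ1 _ (hle _), β.source]
  · rw [hs2, hlast]
  · intro i
    refine Fin.lastCases ?_ (fun j ↦ ?_) i
    · rw [hs3, Fin.succ_last, hs2]
      have he : EqOn γ (fun x ↦ σ (x - c)) (Icc c (c + 1)) := fun x hx ↦ hγ2 x hx.1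
      exact hσ.imp (fun h ↦ (h.shift c).congr he) (fun h ↦ (h.shift c).congr he)
    · rw [hs1, Fin.succ_castSucc, hs1]
      have he : EqOn γ β.toFun (Icc (β.s j.castSucc) (β.s j.succ)) :=
        fun x hx ↦ hγ1 x (hx.2.trans (hle _))
      exact (β.causal j).imp (fun h ↦ h.congr he) (fun h ↦ h.congr he)
  · simp only [nullLength]
    rw [Fin.sum_univ_castSucc]
    congr 1
    · refine Finset.sum_congr rfl fun j _ ↦ ?_
      rw [hs1, Fin.succ_castSucc, hs1, hγ1 _ (hle _), hγ1 _ (hle _)]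
    · rw [hs3, Fin.succ_last, hs2, hlast, hγ1 c le_rfl, hc, β.target]

/-- Only this special triangle inequality is needed. The case `p = q` is separate, since there the
distance is zero by convention and no near-optimal curve is at hand to extend; the single segment is
used instead. -/
theorem nullDist_le_add (f : M → ℝ) (p : M) {q r : M} (h : CausallyJoined θ q r) :
    nullDist θ f p r ≤ nullDist θ f p q + ENNReal.ofReal |f r - f q| := by
  classical
  unfold nullDist
  by_cases hpr : p = r
  · simp [hpr]
  rw [if_neg hpr]
  by_cases hpq : p = q
  · subst hpq
    obtain ⟨β, hβ⟩ := h.exists_curve f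
    rw [if_pos rfl, zero_add, ← hβ]
    exact iInf_le _ β
  · rw [if_neg hpq, ENNReal.iInf_add]
    refine le_iInf fun β ↦ ?_
    obtain ⟨β', hβ'⟩ := h.exists_append f β
    refine (iInf_le _ β').trans ?_
    rw [hβ']
    exact ENNReal.ofReal_add_le

end Concatenation

/-! ### The two-leg zigzag -/

section Zigzag

variable {n : ℕ} {M : Type*} [TopologicalSpace M]
  [ChartedSpace (EuclideanSpace ℝ (Fin (n + 1))) M] [IsManifold (𝓡 (n + 1)) ∞ M]
  {g : LorentzianMetric n M} {θ : TimeOrientation g} {f : M → ℝ}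

/-- The way back runs in a direction close to `-a`, which is again timelike with nonzero `df`. -/
theorem exists_causallyJoined_symm_of_near (hf : IsTemporal θ f)
    (hfs : ContMDiff (𝓡 (n + 1)) 𝓘(ℝ, ℝ) ∞ f) (x₀ : M) {a : EuclideanSpace ℝ (Fin (n + 1))}
    (ha : chartNormSq g x₀ (extChartAt (𝓡 (n + 1)) x₀ x₀) a < 0)
    (hα : chartDeriv f x₀ (extChartAt (𝓡 (n + 1)) x₀ x₀) a ≠ 0) :
    ∃ η > 0, ∀ y z : EuclideanSpace ℝ (Fin (n + 1)), ∀ h > 0,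
      ‖y - extChartAt (𝓡 (n + 1)) x₀ x₀‖ < η → ‖z - extChartAt (𝓡 (n + 1)) x₀ x₀‖ < η →
      ‖z - y - h • a‖ < η * h →
      CausallyJoined θ ((extChartAt (𝓡 (n + 1)) x₀).symm y)
        ((extChartAt (𝓡 (n + 1)) x₀).symm z) ∧
      CausallyJoined θ ((extChartAt (𝓡 (n + 1)) x₀).symm z)
        ((extChartAt (𝓡 (n + 1)) x₀).symm y) := by
  obtain ⟨η₁, h₁, H₁⟩ := exists_causallyJoined_of_near hf hfs x₀ ha hα
  obtain ⟨η₂, h₂, H₂⟩ := exists_causallyJoined_of_near hf hfs x₀ (a := (-1 : ℝ) • a) (g := g)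
    (by rw [chartNormSq_smul]; simpa using ha) (by rw [chartDeriv_smul]; simpa using hα)
  refine ⟨min η₁ η₂, lt_min h₁ h₂, fun y z h hh hy hz hyz ↦ ?_⟩
  refine ⟨H₁ y z h hh (hy.trans_le (min_le_left _ _)) (hz.trans_le (min_le_left _ _))
    (hyz.trans_le (by gcongr; exact min_le_left _ _)),
    H₂ z y h hh (hz.trans_le (min_le_right _ _)) (hy.trans_le (min_le_right _ _)) ?_⟩
  rw [show y - z - h • ((-1 : ℝ) • a) = -(z - y - h • a) by module, norm_neg]
  exact hyz.trans_le (by gcongr; exact min_le_right _ _)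

/-- The vectors `v / 2 + μ X`, where `X` is the gradient scaled so that `df(X) = 1`. -/
theorem exists_timelike_split (hf : IsTemporal θ f) {x : M} {C : ℝ} (hC : 0 < C)
    (hgrad : g.val x (gradient g f x) (gradient g f x) = -C ^ 2)
    {v : TangentSpace (𝓡 (n + 1)) x} (hv : mvfderiv (𝓡 (n + 1)) f x v = 0) {k : ℝ}
    (hk : C * √(g.val x v v) < k) :
    ∃ a b : TangentSpace (𝓡 (n + 1)) x, a + b = v ∧ g.val x a a < 0 ∧ g.val x b b < 0 ∧
      mvfderiv (𝓡 (n + 1)) f x a = k / 2 ∧ mvfderiv (𝓡 (n + 1)) f x b = -(k / 2) := by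
  have h0 := val_nonneg_of_mvfderiv_eq_zero hf hv
  have h1 : g.val x (gradient g f x) v = 0 := by rw [gradient_spec, hv]
  have h2 : mvfderiv (𝓡 (n + 1)) f x (gradient g f x) = -C ^ 2 := by rw [← gradient_spec g, hgrad]
  have h3 : C ^ 2 * g.val x v v < k ^ 2 := by
    rw [← Real.sq_sqrt h0, ← mul_pow]
    exact pow_lt_pow_left₀ hk (by positivity) two_ne_zero
  -- The cross term vanishes by orthogonality, so only `μ²` matters and both signs are handled at
  -- once: the value is `(g(v, v) - k²/C²) / 4`.
  have h4 : ∀ μ : ℝ, μ ^ 2 = (k / (2 * C ^ 2)) ^ 2 →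
      g.val x ((1 / 2 : ℝ) • v + μ • gradient g f x) ((1 / 2 : ℝ) • v + μ • gradient g f x) < 0 := by
    intro μ hμ
    simp only [map_add, map_smul, add_apply, smul_apply, smul_eq_mul]
    rw [g.symm x v (gradient g f x), h1, hgrad]
    have : μ ^ 2 * C ^ 2 = k ^ 2 / (4 * C ^ 2) := by
      rw [hμ]; field_simp; norm_num
    have h5 : g.val x v v < k ^ 2 / C ^ 2 := by rwa [lt_div_iff₀' (by positivity)]
    have h6 : k ^ 2 / (4 * C ^ 2) = k ^ 2 / C ^ 2 / 4 := by field_simp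
    nlinarith
  refine ⟨(1 / 2 : ℝ) • v + (-(k / (2 * C ^ 2))) • gradient g f x,
    (1 / 2 : ℝ) • v + (k / (2 * C ^ 2)) • gradient g f x, by module, h4 _ (by ring), h4 _ rfl, ?_, ?_⟩
  · simp only [map_add, map_smul, smul_eq_mul, h2, hv]
    field_simp; ring
  · simp only [map_add, map_smul, smul_eq_mul, h2, hv]
    field_simp; ring

omit [IsManifold (𝓡 (n + 1)) ∞ M] in
theorem hasDerivAt_comp_chart_line (hfs : MDifferentiable (𝓡 (n + 1)) 𝓘(ℝ, ℝ) f) (x₀ : M)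
    (a : EuclideanSpace ℝ (Fin (n + 1))) :
    HasDerivAt (fun s : ℝ ↦ f ((extChartAt (𝓡 (n + 1)) x₀).symm
      (extChartAt (𝓡 (n + 1)) x₀ x₀ + s • a))) (mvfderiv (𝓡 (n + 1)) f x₀ a) 0 := by
  have h0 := (hfs x₀).hasMFDerivAt.2
  rw [ModelWithCorners.range_eq_univ] at h0
  have h1 : HasFDerivAt (𝕜 := ℝ) (E := EuclideanSpace ℝ (Fin (n + 1))) (F := ℝ)
      (f ∘ (extChartAt (𝓡 (n + 1)) x₀).symm) (mvfderiv (𝓡 (n + 1)) f x₀)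
      (extChartAt (𝓡 (n + 1)) x₀ x₀) := hasFDerivWithinAt_univ.1 h0
  have h2 : HasDerivAt (fun s : ℝ ↦ extChartAt (𝓡 (n + 1)) x₀ x₀ + s • a) a 0 := by
    simpa using ((hasDerivAt_id (0 : ℝ)).smul_const a).const_add (extChartAt (𝓡 (n + 1)) x₀ x₀)
  have h3 : extChartAt (𝓡 (n + 1)) x₀ x₀ = extChartAt (𝓡 (n + 1)) x₀ x₀ + (0 : ℝ) • a := by simp
  rw [h3] at h1
  exact h1.comp_hasDerivAt (0 : ℝ) h2

theorem exists_nullDist_step (hf : IsTemporal θ f)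
    (hfs : ContMDiff (𝓡 (n + 1)) 𝓘(ℝ, ℝ) ∞ f) {x₀ : M} {C : ℝ} (hC : 0 < C)
    (hgrad : g.val x₀ (gradient g f x₀) (gradient g f x₀) = -C ^ 2)
    {v : EuclideanSpace ℝ (Fin (n + 1))} (hv : mvfderiv (𝓡 (n + 1)) f x₀ v = 0) {κ : ℝ}
    (hκ : C * √(g.val x₀ v v) < κ) :
    ∃ η > 0, ∀ h > 0, h < η → ∀ z : EuclideanSpace ℝ (Fin (n + 1)),
      ‖z - extChartAt (𝓡 (n + 1)) x₀ x₀ - h • v‖ ≤ η * h →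
      f ((extChartAt (𝓡 (n + 1)) x₀).symm z) = f x₀ → ∀ p,
      nullDist θ f p ((extChartAt (𝓡 (n + 1)) x₀).symm z) ≤
        nullDist θ f p x₀ + ENNReal.ofReal (κ * h) ∧
      nullDist θ f p x₀ ≤
        nullDist θ f p ((extChartAt (𝓡 (n + 1)) x₀).symm z) + ENNReal.ofReal (κ * h) := by
  -- The gap between `k` and `κ` absorbs the error in the first-order expansion of `f` along `a`.
  obtain ⟨k, hk1, hk2⟩ := exists_between hκ
  have hk0 : 0 < k := lt_of_le_of_lt (by positivity) hk1
  obtain ⟨a, b, hab, ha, hb, hda, hdb⟩ := exists_timelike_split hf hC hgrad hv hk1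
  change EuclideanSpace ℝ (Fin (n + 1)) at a b
  replace hab : a + b = v := hab
  obtain ⟨η₁, hη₁, H₁⟩ := exists_causallyJoined_symm_of_near hf hfs x₀ (a := a) (g := g)
    ((chartNormSq_self x₀ a).trans_lt ha)
    (((chartDeriv_self x₀ a).trans hda).trans_ne (by positivity))
  obtain ⟨η₂, hη₂, H₂⟩ := exists_causallyJoined_symm_of_near hf hfs x₀ (a := b) (g := g)
    ((chartNormSq_self x₀ b).trans_lt hb)
    (((chartDeriv_self x₀ b).trans hdb).trans_ne (neg_ne_zero.2 (by positivity)))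
  have hφ0 := extChartAt_to_inv (I := 𝓡 (n + 1)) x₀
  have hD := hasDerivAt_comp_chart_line hf.1 x₀ a
  set φ := extChartAt (𝓡 (n + 1)) x₀
  have hev : ∀ᶠ s : ℝ in 𝓝[>] 0, |f (φ.symm (φ x₀ + s • a)) - f x₀| ≤ κ / 2 * s := by
    have h1 := (hasDerivAt_iff_tendsto_slope.1 hD).mono_left
      (nhdsWithin_mono (0 : ℝ) (fun s (hs : 0 < s) ↦ hs.ne'))
    have h2 := h1.abs.eventually_lt_const (u := κ / 2)
      (by rw [show mvfderiv (𝓡 (n + 1)) f x₀ a = k / 2 from hda, abs_of_pos (by positivity)]; linarith)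
    filter_upwards [h2, self_mem_nhdsWithin] with s hs hs0
    rw [slope_def_field, zero_smul, add_zero, hφ0, sub_zero, abs_div, abs_of_pos (show 0 < s from hs0),
      div_lt_iff₀ (show 0 < s from hs0)] at hs
    exact hs.le
  obtain ⟨δ, hδ, hδ'⟩ := (mem_nhdsGT_iff_exists_Ioo_subset).1 hev
  -- For `h < η ≤ 1`, the corner is within `η ‖a‖` and the endpoint `z` within `η (1 + ‖v‖)` of the
  -- base point, so both stay where the two legs are causal.
  have hη : ∃ η > 0, η ≤ δ ∧ η ≤ 1 ∧ η * (1 + ‖v‖ + ‖a‖) < η₁ ∧ η * (1 + ‖v‖ + ‖a‖) < η₂ := by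
    have : 0 < 1 + ‖v‖ + ‖a‖ := by positivity
    refine ⟨min (min δ 1) (min η₁ η₂ / (1 + ‖v‖ + ‖a‖) / 2), ?_, ?_, ?_, ?_, ?_⟩
    · have : 0 < min η₁ η₂ := lt_min hη₁ hη₂
      have : 0 < δ := hδ
      positivity
    · exact (min_le_left _ _).trans (min_le_left _ _)
    · exact (min_le_left _ _).trans (min_le_right _ _)
    · have h1 : 0 < min η₁ η₂ := lt_min hη₁ hη₂
      rw [← lt_div_iff₀ this]
      refine (min_le_right _ _).trans_lt ((half_lt_self (by positivity)).trans_le ?_)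
      gcongr
      exact min_le_left _ _
    · have h1 : 0 < min η₁ η₂ := lt_min hη₁ hη₂
      rw [← lt_div_iff₀ this]
      refine (min_le_right _ _).trans_lt ((half_lt_self (by positivity)).trans_le ?_)
      gcongr
      exact min_le_right _ _
  obtain ⟨η, hη0, hηδ, hη1, hη₁', hη₂'⟩ := hη
  refine ⟨η, hη0, fun h hh hhη z hz hfz p ↦ ?_⟩
  have hva : 0 ≤ η * ‖v‖ := by positivity
  have haa : 0 ≤ η * ‖a‖ := by positivity
  have hha : ‖h • a‖ ≤ η * ‖a‖ := by
    rw [norm_smul, Real.norm_of_nonneg hh.le]; gcongr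
  have hr : ‖φ x₀ + h • a - φ x₀‖ < min η₁ η₂ := by
    rw [add_sub_cancel_left, lt_min_iff]
    constructor <;> linarith
  have hz' : ‖z - φ x₀‖ < min η₁ η₂ := by
    have h1 : ‖z - φ x₀‖ ≤ ‖z - φ x₀ - h • v‖ + ‖h • v‖ := norm_le_norm_sub_add _ _
    have h2 : ‖h • v‖ ≤ η * ‖v‖ := by
      rw [norm_smul, Real.norm_of_nonneg hh.le]; gcongr
    have h3 : η * h ≤ η * 1 := by gcongr; linarith
    rw [lt_min_iff]
    constructor <;> linarith
  have hlt : η < min η₁ η₂ := by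
    rw [lt_min_iff]
    constructor <;> linarith
  obtain ⟨j1, j2⟩ := H₁ (φ x₀) (φ x₀ + h • a) h hh (by simpa using hη₁)
    (hr.trans_le (min_le_left _ _)) (by simpa using mul_pos hη₁ hh)
  obtain ⟨j3, j4⟩ := H₂ (φ x₀ + h • a) z h hh (hr.trans_le (min_le_right _ _))
    (hz'.trans_le (min_le_right _ _)) (by
      rw [show z - (φ x₀ + h • a) - h • b = z - φ x₀ - h • v by rw [← hab]; module]
      refine hz.trans_lt ?_
      gcongr
      exact hlt.trans_le (min_le_right _ _))
  rw [hφ0] at j1 j2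
  -- Since `f` takes the same value at both ends of the zigzag, this one bound prices both legs.
  have hfr : |f (φ.symm (φ x₀ + h • a)) - f x₀| ≤ κ / 2 * h := hδ' ⟨hh, hhη.trans_le hηδ⟩
  have hsum : ENNReal.ofReal (κ * h) = ENNReal.ofReal (κ / 2 * h) + ENNReal.ofReal (κ / 2 * h) := by
    have : 0 < κ := hk0.trans hk2
    rw [← ENNReal.ofReal_add (by positivity) (by positivity)]
    congr 1; ring
  rw [hsum, ← add_assoc, ← add_assoc]
  constructor
  · refine (nullDist_le_add f p j3).trans (add_le_add ((nullDist_le_add f p j1).trans ?_) ?_)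
    · gcongr
    · rw [hfz, abs_sub_comm]; gcongr
  · refine (nullDist_le_add f p j2).trans (add_le_add ((nullDist_le_add f p j4).trans ?_) ?_)
    · rw [hfz]; gcongr
    · rw [abs_sub_comm]; gcongr

end Zigzag

/-! ### From local steps to the length of a level curve -/

section LevelCurves

variable {n : ℕ} {M : Type*} [TopologicalSpace M]
  [ChartedSpace (EuclideanSpace ℝ (Fin (n + 1))) M] [IsManifold (𝓡 (n + 1)) ∞ M]
  {g : LorentzianMetric n M} {θ : TimeOrientation g} {f : M → ℝ}

/-- The speed of a curve defined on `[0, 1]`. -/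
noncomputable def speed (g : LorentzianMetric n M) (γ : ℝ → M) (s : ℝ) : ℝ :=
  √(g.val (γ s) (velocity γ 0 1 s) (velocity γ 0 1 s))

theorem continuousOn_speed (g : LorentzianMetric n M) {γ : ℝ → M}
    (hγ : ContMDiffOn 𝓘(ℝ, ℝ) (𝓡 (n + 1)) 1 γ (Icc 0 1)) : ContinuousOn (speed g γ) (Icc 0 1) := by
  have h := hγ.continuousOn_tangentMapWithin le_rfl (uniqueDiffOn_Icc zero_lt_one).uniqueMDiffOn
  have h1 : Continuous fun s : ℝ ↦ (⟨s, (1 : ℝ)⟩ : TangentBundle 𝓘(ℝ, ℝ) ℝ) :=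
    (tangentBundleModelSpaceHomeomorph 𝓘(ℝ, ℝ)).symm.continuous.comp
      (continuous_id.prodMk continuous_const)
  have h2 := h.comp (s := Icc (0 : ℝ) 1) h1.continuousOn fun s hs ↦ hs
  exact ((continuous_val_self g).comp_continuousOn h2).sqrt

omit [IsManifold (𝓡 (n + 1)) ∞ M] in
theorem hasDerivWithinAt_extChartAt_comp {γ : ℝ → M}
    (hγ : ContMDiffOn 𝓘(ℝ, ℝ) (𝓡 (n + 1)) 1 γ (Icc 0 1)) {s₀ : ℝ} (hs₀ : s₀ ∈ Icc (0 : ℝ) 1) :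
    HasDerivWithinAt (F := EuclideanSpace ℝ (Fin (n + 1)))
      (fun s ↦ extChartAt (𝓡 (n + 1)) (γ s₀) (γ s)) (velocity (n := n) γ 0 1 s₀) (Icc 0 1) s₀ := by
  have h := ((hγ s₀ hs₀).mdifferentiableWithinAt one_ne_zero).hasMFDerivWithinAt.2
  simp only [mfld_simps] at h
  have h' : ∀ (F : ℝ → EuclideanSpace ℝ (Fin (n + 1))) (L : ℝ →L[ℝ] EuclideanSpace ℝ (Fin (n + 1))),
      HasFDerivWithinAt F L (Icc 0 1) s₀ → HasDerivWithinAt F (L 1) (Icc 0 1) s₀ :=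
    fun _ _ hF ↦ hF.hasDerivWithinAt
  exact h' _ _ h

theorem LevelCurve.exists_nullDist_step (hf : IsTemporal θ f)
    (hfs : ContMDiff (𝓡 (n + 1)) 𝓘(ℝ, ℝ) ∞ f) {t C : ℝ} (hC : 0 < C)
    (hgrad : ∀ x ∈ f ⁻¹' {t}, g.val x (gradient g f x) (gradient g f x) = -C ^ 2)
    {p q : M} (γ : LevelCurve n f t p q) {s₀ : ℝ} (hs₀ : s₀ ∈ Icc (0 : ℝ) 1) {κ : ℝ}
    (hκ : C * speed g γ.toFun s₀ < κ) :
    ∃ δ > 0, ∀ s ∈ Icc (0 : ℝ) 1, |s - s₀| < δ → ∀ r,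
      nullDist θ f r (γ.toFun s) ≤
        nullDist θ f r (γ.toFun s₀) + ENNReal.ofReal (κ * |s - s₀|) ∧
      nullDist θ f r (γ.toFun s₀) ≤
        nullDist θ f r (γ.toFun s) + ENNReal.ofReal (κ * |s - s₀|) := by
  set x₀ := γ.toFun s₀ with hx₀
  have hx₀t : f x₀ = t := γ.mem s₀ hs₀
  have hv : mvfderiv (𝓡 (n + 1)) f x₀ (velocity γ.toFun 0 1 s₀) = 0 := γ.velocity_mem hf.1 hs₀
  have hv' : mvfderiv (𝓡 (n + 1)) f x₀ (-velocity γ.toFun 0 1 s₀) = 0 := by rw [map_neg, hv, neg_zero]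
  obtain ⟨η₁, hη₁, H₁⟩ := Spacetime.exists_nullDist_step hf hfs hC (hgrad x₀ hx₀t) hv hκ
  -- Parameters before `s₀` are reached along `-v` with `h = s₀ - s`, which has the same speed.
  obtain ⟨η₂, hη₂, H₂⟩ := Spacetime.exists_nullDist_step hf hfs hC (hgrad x₀ hx₀t) hv' (κ := κ)
    (by simp only [map_neg, neg_apply, neg_neg]; exact hκ)
  have hη : 0 < min η₁ η₂ := lt_min hη₁ hη₂
  have hD := (hasDerivWithinAt_iff_isLittleO.1
    (hasDerivWithinAt_extChartAt_comp γ.contMDiffOn hs₀)).bound hη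
  have hsrc : ∀ᶠ s in 𝓝[Icc 0 1] s₀, γ.toFun s ∈ (extChartAt (𝓡 (n + 1)) x₀).source :=
    (γ.contMDiffOn.continuousOn s₀ hs₀).eventually_mem (extChartAt_source_mem_nhds x₀)
  obtain ⟨ε, hε, hball⟩ := Metric.mem_nhdsWithin_iff.1 (hD.and hsrc)
  refine ⟨min ε (min η₁ η₂), lt_min hε hη, fun s hs hss r ↦ ?_⟩
  obtain ⟨h1, h2⟩ := hball ⟨by
    rw [Metric.mem_ball, Real.dist_eq]; exact hss.trans_le (min_le_left _ _), hs⟩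
  have hinv : (extChartAt (𝓡 (n + 1)) x₀).symm (extChartAt (𝓡 (n + 1)) x₀ (γ.toFun s)) =
    γ.toFun s := (extChartAt (𝓡 (n + 1)) x₀).left_inv h2
  have hft : f (γ.toFun s) = f x₀ := by rw [hx₀t, γ.mem s hs]
  rw [Real.norm_eq_abs] at h1
  have hss' := hss.trans_le (min_le_right _ _)
  rcases lt_trichotomy s s₀ with h | rfl | h
  · have h0 : |s - s₀| = s₀ - s := by rw [abs_sub_comm, abs_of_pos (sub_pos.2 h)]
    rw [h0] at h1 hss' ⊢
    have := H₂ (s₀ - s) (sub_pos.2 h) (hss'.trans_le (min_le_right _ _))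
      (extChartAt (𝓡 (n + 1)) x₀ (γ.toFun s)) ?_ (by rw [hinv, hft]) r
    · rwa [hinv] at this
    · have hneg : ∀ w : EuclideanSpace ℝ (Fin (n + 1)), (s₀ - s) • (-w) = (s - s₀) • w := by
        intro w; module
      refine (congrArg (fun w ↦ ‖extChartAt (𝓡 (n + 1)) x₀ (γ.toFun s) -
        extChartAt (𝓡 (n + 1)) x₀ x₀ - w‖) (hneg _)).trans_le (h1.trans ?_)
      gcongr
      exact min_le_right _ _
  · simp [hx₀]
  · have h0 : |s - s₀| = s - s₀ := abs_of_pos (sub_pos.2 h)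
    rw [h0] at h1 hss' ⊢
    have := H₁ (s - s₀) (sub_pos.2 h) (hss'.trans_le (min_le_left _ _))
      (extChartAt (𝓡 (n + 1)) x₀ (γ.toFun s)) ?_ (by rw [hinv, hft]) r
    · rwa [hinv] at this
    · exact h1.trans (by gcongr; exact min_le_left _ _)

/-- An interval is exhausted by a transitive relation that holds near each of its points. -/
theorem rel_Icc_of_local {P : ℝ → ℝ → Prop} {a b : ℝ} (hab : a ≤ b)
    (htrans : ∀ x y z, a ≤ x → x ≤ y → y ≤ z → z ≤ b → P x y → P y z → P x z)
    (hloc : ∀ x ∈ Icc a b, ∃ δ > 0, ∀ y ∈ Icc a b, |y - x| < δ →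
      (y ≤ x → P y x) ∧ (x ≤ y → P x y)) : P a b := by
  -- Locality to the left of `sSup S` puts the supremum in `S`; locality to the right would push
  -- past it unless it equals `b`.
  set S := {x | x ∈ Icc a b ∧ P a x} with hS
  have hrefl : P a a := by
    obtain ⟨δ, hδ, h⟩ := hloc a ⟨le_rfl, hab⟩
    exact (h a ⟨le_rfl, hab⟩ (by simpa using hδ)).1 le_rfl
  have hne : S.Nonempty := ⟨a, ⟨le_rfl, hab⟩, hrefl⟩
  have hbdd : BddAbove S := ⟨b, fun x hx ↦ hx.1.2⟩
  set c := sSup S with hc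
  have hcI : c ∈ Icc a b := ⟨le_csSup hbdd ⟨⟨le_rfl, hab⟩, hrefl⟩, csSup_le hne fun x hx ↦ hx.1.2⟩
  obtain ⟨δ, hδ, h⟩ := hloc c hcI
  have hcS : P a c := by
    obtain ⟨x, hx, hxc⟩ := exists_lt_of_lt_csSup hne (sub_lt_self c hδ)
    have hxc' : x ≤ c := le_csSup hbdd hx
    exact htrans a x c le_rfl hx.1.1 hxc' hcI.2 hx.2
      ((h x hx.1 (by rw [abs_sub_lt_iff]; constructor <;> linarith)).1 hxc')
  rcases hcI.2.eq_or_lt with hcb | hcb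
  · rwa [← hcb]
  · exfalso
    obtain ⟨d, hd1, hd2⟩ := exists_between (lt_min hcb (lt_add_of_pos_right c hδ))
    have hdb : d ≤ b := (hd2.trans_le (min_le_left _ _)).le
    have hdI : d ∈ Icc a b := ⟨hcI.1.trans hd1.le, hdb⟩
    have hdδ : d < c + δ := hd2.trans_le (min_le_right _ _)
    have hPd := htrans a c d le_rfl hcI.1 hd1.le hdb hcS
      ((h d hdI (by rw [abs_sub_lt_iff]; constructor <;> linarith)).2 hd1.le)
    exact hd1.not_ge (le_csSup hbdd ⟨hdI, hPd⟩)

theorem LevelCurve.nullDist_le_lintegral (hf : IsTemporal θ f)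
    (hfs : ContMDiff (𝓡 (n + 1)) 𝓘(ℝ, ℝ) ∞ f) {t C : ℝ} (hC : 0 < C)
    (hgrad : ∀ x ∈ f ⁻¹' {t}, g.val x (gradient g f x) (gradient g f x) = -C ^ 2)
    {p q : M} (γ : LevelCurve n f t p q) {ε : ℝ} (hε : 0 < ε) :
    nullDist θ f p q ≤ ∫⁻ s in Ioc (0 : ℝ) 1, ENNReal.ofReal (C * speed g γ.toFun s + ε) := by
  set F : ℝ → ℝ≥0∞ := fun s ↦ ENNReal.ofReal (C * speed g γ.toFun s + ε) with hF
  -- Quantifying over every base point `r` makes the relation transitive by additivity of the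
  -- integral, with no general triangle inequality.
  have key := rel_Icc_of_local (P := fun a b ↦ ∀ r, nullDist θ f r (γ.toFun b) ≤
    nullDist θ f r (γ.toFun a) + ∫⁻ s in Ioc a b, F s) zero_le_one ?_ ?_
  · have h := key p
    rw [γ.source, γ.target] at h
    simpa [nullDist] using h
  · intro x y z _ hxy hyz _ h1 h2 r
    refine (h2 r).trans ?_
    rw [← Ioc_union_Ioc_eq_Ioc hxy hyz, lintegral_union measurableSet_Ioc
      (Ioc_disjoint_Ioc_of_le le_rfl), ← add_assoc]
    gcongr
    exact h1 r
  · intro x hx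
    -- Half of `ε` gives the strict inequality that the zigzag needs; the other half keeps the
    -- integrand above this constant near `x`.
    obtain ⟨δ₁, hδ₁, H₁⟩ := γ.exists_nullDist_step (g := g) (κ := C * speed g γ.toFun x + ε / 2)
      hf hfs hC hgrad hx (by linarith)
    have hev : ∀ᶠ s in 𝓝[Icc 0 1] x, C * speed g γ.toFun x + ε / 2 < C * speed g γ.toFun s + ε :=
      (((continuousOn_speed g γ.contMDiffOn x hx).const_mul C).add_const ε).eventually_const_lt
        (by linarith)
    obtain ⟨δ₂, hδ₂, H₂⟩ := Metric.mem_nhdsWithin_iff.1 hev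
    have hint : ∀ u v, u ∈ Icc (0 : ℝ) 1 → v ∈ Icc (0 : ℝ) 1 → |u - x| < δ₂ → |v - x| < δ₂ → u ≤ v →
        ENNReal.ofReal ((C * speed g γ.toFun x + ε / 2) * (v - u)) ≤ ∫⁻ s in Ioc u v, F s := by
      intro u v hu hv hux hvx huv
      have hκ : 0 ≤ C * speed g γ.toFun x + ε / 2 := by
        have : 0 ≤ speed g γ.toFun x := Real.sqrt_nonneg _
        positivity
      rw [ENNReal.ofReal_mul hκ, ← Real.volume_Ioc, ← setLIntegral_const]
      refine setLIntegral_mono' measurableSet_Ioc fun s hs ↦ ENNReal.ofReal_le_ofReal ?_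
      refine (H₂ ⟨?_, hu.1.trans hs.1.le, hs.2.trans hv.2⟩ : _ < _).le
      rw [Metric.mem_ball, Real.dist_eq, abs_sub_lt_iff]
      rw [abs_sub_lt_iff] at hux hvx
      constructor <;> linarith [hs.1, hs.2]
    refine ⟨min δ₁ δ₂, lt_min hδ₁ hδ₂, fun y hy hyx ↦ ⟨fun hle r ↦ ?_, fun hle r ↦ ?_⟩⟩
    · refine ((H₁ y hy (hyx.trans_le (min_le_left _ _)) r).2).trans ?_
      gcongr
      rw [abs_sub_comm, abs_of_nonneg (sub_nonneg.2 hle)]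
      exact hint y x hy hx (hyx.trans_le (min_le_right _ _)) (by simpa using hδ₂) hle
    · refine ((H₁ y hy (hyx.trans_le (min_le_left _ _)) r).1).trans ?_
      gcongr
      rw [abs_of_nonneg (sub_nonneg.2 hle)]
      exact hint x y hx hy (by simpa using hδ₂) (hyx.trans_le (min_le_right _ _)) hle

theorem LevelCurve.nullDist_le_mul_levelLength (hf : IsTemporal θ f)
    (hfs : ContMDiff (𝓡 (n + 1)) 𝓘(ℝ, ℝ) ∞ f) {t C : ℝ} (hC : 0 < C)
    (hgrad : ∀ x ∈ f ⁻¹' {t}, g.val x (gradient g f x) (gradient g f x) = -C ^ 2)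
    {p q : M} (γ : LevelCurve n f t p q) :
    nullDist θ f p q ≤ ENNReal.ofReal C * levelLength g hf.1 γ := by
  have hlen : levelLength g hf.1 γ = ∫⁻ s in Icc (0 : ℝ) 1, ENNReal.ofReal (speed g γ.toFun s) :=
    lintegral_subtype_comap measurableSet_Icc fun s ↦ ENNReal.ofReal (speed g γ.toFun s)
  refine ENNReal.le_of_forall_pos_le_add fun ε hε _ ↦ ?_
  refine (γ.nullDist_le_lintegral hf hfs hC hgrad (NNReal.coe_pos.2 hε)).trans ?_
  have h1 : ∀ s, ENNReal.ofReal (C * speed g γ.toFun s + ε) =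
      ENNReal.ofReal C * ENNReal.ofReal (speed g γ.toFun s) + ε := by
    intro s
    have : 0 ≤ speed g γ.toFun s := Real.sqrt_nonneg _
    rw [ENNReal.ofReal_add (by positivity) ε.coe_nonneg, ENNReal.ofReal_mul hC.le, ENNReal.ofReal_coe_nnreal]
  simp only [h1]
  rw [lintegral_add_right _ measurable_const, lintegral_const_mul' _ _ ENNReal.ofReal_ne_top,
    setLIntegral_const, Real.volume_Ioc, hlen]
  simp only [sub_zero, ENNReal.ofReal_one, mul_one]
  gcongr
  exact Ioc_subset_Icc_self

end LevelCurves

end Spacetime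

theorem theorem1p1 {n : ℕ} {M : Type*} [TopologicalSpace M] [T2Space M]
    [SecondCountableTopology M] [ConnectedSpace M]
    [ChartedSpace (EuclideanSpace ℝ (Fin (n + 1))) M] [IsManifold (𝓡 (n + 1)) ∞ M]
    (g : Spacetime.LorentzianMetric n M) (θ : Spacetime.TimeOrientation g)
    (f : M → ℝ) (hf : ContMDiff (𝓡 (n + 1)) 𝓘(ℝ, ℝ) ∞ f) (hfθ : Spacetime.IsTemporal θ f)
    (t C : ℝ) (hC : 0 < C) (hne : (f ⁻¹' {t}).Nonempty)
    (hgrad : ∀ x ∈ f ⁻¹' {t},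
      g.val x (Spacetime.gradient g f x) (Spacetime.gradient g f x) = -C ^ 2) :
    ∀ p ∈ f ⁻¹' {t}, ∀ q ∈ f ⁻¹' {t},
      Spacetime.nullDist θ f p q ≤ ENNReal.ofReal C * Spacetime.levelDist g hfθ.1 t p q := by
  intro p _ q _
  -- A factor that is neither zero nor infinite passes through the infimum, even over an empty
  -- family of curves.
  rw [Spacetime.levelDist, ENNReal.mul_iInf_of_ne (ENNReal.ofReal_pos.2 hC).ne'
    ENNReal.ofReal_ne_top]
  exact le_iInf fun γ ↦ γ.nullDist_le_mul_levelLength hfθ hf hC hgrad
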